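/- Let $\alpha_1,\alpha_2\in(0,1)$ and $\lambda,\mu>0$. For $\alpha\in(0,1)$ and $\nu>0$, the Mittag-Leffler law with tail index $\alpha$ and scaling $\nu$ is the law on $[0,\infty)$ with cumulative distribution function $$F_{\alpha,\nu}(x)=1-E_{\alpha,1}(-\nu^\alpha x^\alpha),\quad x\ge 0,\qquad E_{\alpha,1}(z)=\sum_{\ell=0}^\infty \frac{z^\ell}{\Gamma(1+\alpha \ell)}.$$ On a probability space, let $(X_i)_{i\ge1}$ be i.i.d. with the Mittag-Leffler law with tail index $\alpha_1$ and scaling $\lambda$ (inter-arrival times), and let $(Y_i)_{i\ge1}$ be i.i.d. with the Mittag-Leffler law with tail index $\alpha_2$ and scaling $\mu$ (service times), the two sequences being independent of each other. Let $$N^{(\alpha_1)}_\lambda(t)=\max\Big\{k\ge0:\sum_{i=1}^kX_i\le t\Big\},\qquad N^{(\alpha_2)}_\mu(t)=\max\Big\{k\ge0:\sum_{i=1}^kY_i\le t\Big\},\qquad t\ge 0,$$ be the corresponding renewal counting processes, and define the length of the Mittag-Leffler GI/GI/1 queue by $$L(t)=\big(N^{(\alpha_1)}_\lambda(t)-N^{(\alpha_2)}_\mu(t)\big)-\inf_{0\le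 s\le t}\big(N^{(\alpha_1)}_\lambda(s)-N^{(\alpha_2)}_\mu(s)\big),\qquad t\ge0.$$ 1. If $\alpha_1<\alpha_2$, then almost surely $L(t)=0$ infinitely often, that is, the set $\{t\ge0: L(t)=0\}$ is unbounded. 2. If $\alpha_1>\alpha_2$, then almost surely $\limsup_{t\to\infty}L(t)=\infty$. -/

import Mathlib

open MeasureTheory ProbabilityTheory Filter Set

noncomputable section

namespace MLQueue

/-- The two-parameter Mittag-Leffler function `E_{α,β}(z) = ∑ z^ℓ / Γ(β + α ℓ)`, for real `z`. -/
def mittagLeffler (α β z : ℝ) : ℝ :=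
  ∑' l : ℕ, z ^ l / Real.Gamma (β + α * l)

/-- The cumulative distribution function of the Mittag-Leffler law with tail index `α` and
scaling `ν`: it is `1 - E_{α,1}(-ν^α x^α)` for `x ≥ 0` and vanishes on the negative axis. -/
def mittagLefflerCDF (α ν x : ℝ) : ℝ :=
  if x < 0 then 0 else 1 - mittagLeffler α 1 (-(ν ^ α * x ^ α))

/-- `T 0, T 1, …` are independent random variables, each of which has the Mittag-Leffler law with
tail index `α` and scaling `ν`. -/
structure IsMittagLefflerSequence {Ω : Type*} [MeasurableSpace Ω] (P : Measure Ω)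
    (α ν : ℝ) (T : ℕ → Ω → ℝ) : Prop where
  measurable : ∀ i, Measurable (T i)
  indep : iIndepFun T P
  law : ∀ i x, P.real {ω | T i ω ≤ x} = mittagLefflerCDF α ν x

/-- The renewal counting process with inter-event times `T 0, T 1, …`, along one sample path:
the largest `k` for which the `k`-th event time `T 0 + … + T (k - 1)` is at most `t`. -/
def count (T : ℕ → ℝ) (t : ℝ) : ℕ :=
  sSup {k : ℕ | ∑ i ∈ Finset.range k, T i ≤ t}

/-- Arrivals minus departure attempts up to time `t`, along one sample path. -/
def netInput (X Y : ℕ → ℝ) (t : ℝ) : ℤ :=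
  (count X t : ℤ) - (count Y t : ℤ)

/-- The queue length at time `t ≥ 0`, along one sample path with inter-arrival times `X` and
service times `Y`: the net input reflected at its running infimum over `[0, t]`. -/
def queueLength (X Y : ℕ → ℝ) (t : ℝ) : ℤ :=
  netInput X Y t - sInf (netInput X Y '' Icc 0 t)

end MLQueue

end

/-!
Write `ψ(s) = 1 - E[exp (-s T)]`. The sum of `k` independent copies of `T` has Laplace transform
`(1 - ψ(s)) ^ k`, so taking `s = 1 / t` in the Chernoff and Markov inequalities shows that the sum
exceeds `t` with high probability once `k ψ(1 / t)` is large and stays below `t` with high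
probability while `k ψ(1 / t)` is small. If the defect `ψ_B` of one renewal sequence is negligible
against the defect `ψ_A` of another, then `k(t) = ⌈1 / √(ψ_A(1 / t) ψ_B(1 / t))⌉` separates the two
regimes: with probability tending to one, at time `t` the process `A` has made at most `k(t)` jumps
and `B` at least `k(t) + M`. Events of probability tending to one almost surely occur at arbitrarily
late times, so `B` gets ahead of `A` by any given amount infinitely often. The queue empties when
the services get ahead in this way, and grows without bound when the arrivals do.

For the Mittag-Leffler law `ψ(s) = s ^ α / (s ^ α + ν ^ α)`, which is of order `s ^ α` as `s → 0+`,
so the smaller tail index has the dominant defect.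
-/

namespace MLQueue

open Asymptotics
open scoped Topology

section SamplePaths

variable {T X Y : ℕ → ℝ} {t : ℝ} {n : ℕ}

lemma monotone_sum_range (hT : ∀ i, 0 ≤ T i) : Monotone fun k => ∑ i ∈ Finset.range k, T i :=
  monotone_nat_of_le_succ fun k => by
    rw [Finset.sum_range_succ]
    exact le_add_of_nonneg_right (hT k)

lemma le_count (hT : Tendsto (fun k => ∑ i ∈ Finset.range k, T i) atTop atTop)
    (h : ∑ i ∈ Finset.range n, T i ≤ t) : n ≤ count T t := by
  obtain ⟨N, hN⟩ := eventually_atTop.1 (hT.eventually_gt_atTop t)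
  exact le_csSup ⟨N, fun k hk => not_lt.1 fun hlt => (hN k hlt.le).not_ge hk⟩ h

lemma count_le (hT : ∀ i, 0 ≤ T i) (h : t < ∑ i ∈ Finset.range n, T i) : count T t ≤ n :=
  csSup_le' fun _k hk => not_lt.1 fun hlt => (h.trans_le (monotone_sum_range hT hlt.le)).not_ge hk

lemma monotone_count (hT : Tendsto (fun k => ∑ i ∈ Finset.range k, T i) atTop atTop) :
    Monotone (count T) :=
  fun _s _t hst => csSup_le' fun _k hk => le_count hT (le_trans hk hst)

lemma bddBelow_netInput_image_Icc
    (hY : Tendsto (fun k => ∑ i ∈ Finset.range k, Y i) atTop atTop) (t : ℝ) :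
    BddBelow (netInput X Y '' Icc 0 t) := by
  refine ⟨-(count Y t : ℤ), ?_⟩
  rintro _ ⟨s, hs, rfl⟩
  have hcount : count Y s ≤ count Y t := monotone_count hY hs.2
  simp only [netInput]
  lia

/-- A time minimising the net input over `[0, t]` is a time at which the queue is empty, and it is
late when the net input at `t` lies below everything attained early on. -/
lemma frequently_queueLength_eq_zero
    (hY : Tendsto (fun k => ∑ i ∈ Finset.range k, Y i) atTop atTop)
    (h : ∀ M : ℕ, ∃ᶠ t in atTop, count X t + M ≤ count Y t) :
    ∃ᶠ t in atTop, queueLength X Y t = 0 := by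
  refine frequently_atTop.2 fun r => ?_
  obtain ⟨t, hcount, ht⟩ := ((h (count Y r + 1)).and_eventually (eventually_ge_atTop 0)).exists
  have hbdd := bddBelow_netInput_image_Icc (X := X) hY t
  obtain ⟨s, hs, hsInf⟩ := Int.csInf_mem ((nonempty_Icc.2 ht).image (netInput X Y)) hbdd
  have hmin : ∀ u ∈ Icc 0 t, netInput X Y s ≤ netInput X Y u := fun u hu =>
    hsInf.trans_le (csInf_le hbdd (mem_image_of_mem _ hu))
  refine ⟨s, ?_, ?_⟩
  · by_contra! hsr
    have hYs : count Y s ≤ count Y r := monotone_count hY hsr.le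
    have hst := hmin t (right_mem_Icc.2 ht)
    simp only [netInput] at hst
    lia
  · have hleast : IsLeast (netInput X Y '' Icc 0 s) (netInput X Y s) :=
      ⟨mem_image_of_mem _ (right_mem_Icc.2 hs.1),
        forall_mem_image.2 fun u hu => hmin u (Icc_subset_Icc_right hs.2 hu)⟩
    rw [queueLength, hleast.csInf_eq, sub_self]

lemma limsup_queueLength_eq_top
    (hY : Tendsto (fun k => ∑ i ∈ Finset.range k, Y i) atTop atTop)
    (h : ∀ M : ℕ, ∃ᶠ t in atTop, count Y t + M ≤ count X t) :
    limsup (fun t : ℝ => ((queueLength X Y t : ℝ) : EReal)) atTop = ⊤ := by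
  refine EReal.eq_top_iff_forall_lt _ |>.2 fun y => ?_
  obtain ⟨m, hm⟩ := exists_nat_gt y
  refine (EReal.coe_lt_coe_iff.2 hm).trans_le (le_limsup_of_frequently_le ?_)
  refine ((h (m + count X 0)).and_eventually (eventually_ge_atTop 0)).mono fun t ⟨hcount, ht⟩ => ?_
  have hinf : sInf (netInput X Y '' Icc 0 t) ≤ netInput X Y 0 :=
    csInf_le (bddBelow_netInput_image_Icc hY t) (mem_image_of_mem _ (left_mem_Icc.2 ht))
  have hm_le : (m : ℤ) ≤ queueLength X Y t := by
    zify at hcount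
    simp only [queueLength, netInput] at hinf ⊢
    linarith
  exact EReal.coe_le_coe_iff.2 (mod_cast hm_le)

end SamplePaths

section LaplaceDefect

variable {Ω : Type*} [MeasurableSpace Ω] {P : Measure Ω} {T : Ω → ℝ} {s t : ℝ}

/-- The defect `1 - E[exp (-s T)]` of the Laplace transform of `T` at `s`. For a nonnegative `T` its
decay as `s → 0+` measures how heavy the tail of `T` is. -/
noncomputable def laplaceDefect (P : Measure Ω) (T : Ω → ℝ) (s : ℝ) : ℝ :=
  1 - mgf T P (-s)

lemma laplaceDefect_le_one : laplaceDefect P T s ≤ 1 :=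
  sub_le_self _ mgf_nonneg

lemma integrable_exp_neg_mul [IsFiniteMeasure P] (hm : AEMeasurable T P) (h0 : 0 ≤ᵐ[P] T)
    (hs : 0 ≤ s) : Integrable (fun ω => Real.exp (-s * T ω)) P := by
  refine Integrable.of_bound (by fun_prop) 1 (h0.mono fun ω hω => ?_)
  rw [Real.norm_eq_abs, Real.abs_exp, Real.exp_le_one_iff]
  exact mul_nonpos_of_nonpos_of_nonneg (neg_nonpos.2 hs) hω

lemma measureReal_le_le_mul_one_sub_laplaceDefect [IsFiniteMeasure P] (hm : AEMeasurable T P)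
    (h0 : 0 ≤ᵐ[P] T) (ht : 0 < t) :
    P.real {ω | T ω ≤ t} ≤ Real.exp 1 * (1 - laplaceDefect P T t⁻¹) := by
  have ht' : 0 ≤ t⁻¹ := (inv_pos.2 ht).le
  have hchernoff := measure_le_le_exp_mul_mgf t (neg_nonpos.2 ht')
    (integrable_exp_neg_mul hm h0 ht')
  rwa [neg_neg, inv_mul_cancel₀ ht.ne', ← sub_sub_self 1 (mgf T P (-t⁻¹))] at hchernoff

lemma analyticOnNhd_laplaceDefect [IsFiniteMeasure P] (hm : AEMeasurable T P)
    (h0 : 0 ≤ᵐ[P] T) : AnalyticOnNhd ℝ (laplaceDefect P T) (Ioi 0) := by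
  have hsub : Iio 0 ⊆ interior (integrableExpSet T P) :=
    interior_maximal (fun x (hx : x < 0) => by
      simpa only [neg_neg, integrableExpSet, mem_ofPred_eq] using
        integrable_exp_neg_mul hm h0 (neg_nonneg.2 hx.le)) isOpen_Iio
  exact fun s (hs : 0 < s) => analyticAt_const.sub
    (AnalyticAt.fun_comp (analyticOnNhd_mgf _ (hsub (mem_Iio.2 (neg_lt_zero.2 hs))))
      analyticAt_id.neg)

lemma one_sub_exp_neg_mul_nonneg (h0 : 0 ≤ᵐ[P] T) (hs : 0 ≤ s) :
    0 ≤ᵐ[P] fun ω => 1 - Real.exp (-s * T ω) :=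
  h0.mono fun _ω hω => sub_nonneg.2 <|
    Real.exp_le_one_iff.2 (mul_nonpos_of_nonpos_of_nonneg (neg_nonpos.2 hs) hω)

variable [IsProbabilityMeasure P]

lemma laplaceDefect_eq_integral (hm : AEMeasurable T P) (h0 : 0 ≤ᵐ[P] T) (hs : 0 ≤ s) :
    laplaceDefect P T s = ∫ ω, (1 - Real.exp (-s * T ω)) ∂P := by
  rw [integral_sub (integrable_const _) (integrable_exp_neg_mul hm h0 hs), laplaceDefect, mgf]
  simp

lemma laplaceDefect_pos (hm : AEMeasurable T P) (h0 : 0 ≤ᵐ[P] T) (hne : ¬ T =ᵐ[P] 0)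
    (hs : 0 < s) : 0 < laplaceDefect P T s := by
  have hnonneg := one_sub_exp_neg_mul_nonneg h0 hs.le
  rw [laplaceDefect_eq_integral hm h0 hs.le]
  refine (integral_nonneg_of_ae hnonneg).lt_of_ne' fun hzero => hne ?_
  have hae := (integral_eq_zero_iff_of_nonneg_ae hnonneg
    ((integrable_const _).sub (integrable_exp_neg_mul hm h0 hs.le))).1 hzero
  filter_upwards [hae] with ω hω
  simpa [sub_eq_zero, hs.ne', eq_comm (a := (1 : ℝ))] using hω

lemma measureReal_lt_le_mul_laplaceDefect (hm : AEMeasurable T P) (h0 : 0 ≤ᵐ[P] T) (ht : 0 < t) :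
    P.real {ω | t < T ω} ≤ (1 - Real.exp (-1))⁻¹ * laplaceDefect P T t⁻¹ := by
  have ht' : 0 ≤ t⁻¹ := (inv_pos.2 ht).le
  have hc : 0 < 1 - Real.exp (-1) := sub_pos.2 (Real.exp_lt_one_iff.2 (by norm_num))
  have hsub : {ω | t < T ω} ⊆ {ω | 1 - Real.exp (-1) ≤ 1 - Real.exp (-t⁻¹ * T ω)} := by
    intro ω (hω : t < T ω)
    have hone : 1 ≤ t⁻¹ * T ω := by
      rw [inv_mul_eq_div, one_le_div ht]
      exact hω.le
    simp only [mem_ofPred_eq]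
    gcongr
    linarith
  rw [inv_mul_eq_div, le_div_iff₀' hc, laplaceDefect_eq_integral hm h0 ht']
  calc (1 - Real.exp (-1)) * P.real {ω | t < T ω}
      ≤ (1 - Real.exp (-1)) * P.real {ω | 1 - Real.exp (-1) ≤ 1 - Real.exp (-t⁻¹ * T ω)} :=
        mul_le_mul_of_nonneg_left (measureReal_mono hsub) hc.le
    _ ≤ ∫ ω, (1 - Real.exp (-t⁻¹ * T ω)) ∂P :=
        mul_meas_ge_le_integral_of_nonneg (one_sub_exp_neg_mul_nonneg h0 ht')
          ((integrable_const _).sub (integrable_exp_neg_mul hm h0 ht')) _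

lemma intervalIntegral_mul_exp_neg_mul (s x : ℝ) :
    ∫ t in (0 : ℝ)..x, s * Real.exp (-(s * t)) = 1 - Real.exp (-s * x) := by
  have hderiv : ∀ t ∈ uIcc 0 x,
      HasDerivAt (fun t => -Real.exp (-(s * t))) (s * Real.exp (-(s * t))) t := fun t _ => by
    have hlin : HasDerivAt (fun t => -(s * t)) (-s) t := by
      simpa only [id_eq, mul_one] using ((hasDerivAt_id t).const_mul s).fun_neg
    exact hlin.exp.fun_neg.congr_deriv (by ring)
  rw [intervalIntegral.integral_eq_sub_of_hasDerivAt hderiv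
    (Continuous.intervalIntegrable (by fun_prop) _ _)]
  simp only [mul_zero, neg_zero, Real.exp_zero, neg_mul]
  ring

lemma laplaceDefect_eq_integral_tail (hm : AEMeasurable T P) (h0 : 0 ≤ᵐ[P] T) (hs : 0 ≤ s) :
    laplaceDefect P T s =
      ∫ t in Ioi 0, P.real {ω | t < T ω} * (s * Real.exp (-(s * t))) := by
  have hdensity : Continuous fun t => s * Real.exp (-(s * t)) := by fun_prop
  have hanti : Antitone fun t => P.real {ω | t < T ω} := fun a b hab =>
    measureReal_mono fun ω (hω : b < T ω) => hab.trans_lt hω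
  have hlayercake := lintegral_comp_eq_lintegral_meas_lt_mul P h0 hm
    (fun t _ => hdensity.intervalIntegrable 0 t) (ae_of_all _ fun t => by positivity)
  simp only [intervalIntegral_mul_exp_neg_mul] at hlayercake
  rw [laplaceDefect_eq_integral hm h0 hs,
    integral_eq_lintegral_of_nonneg_ae (one_sub_exp_neg_mul_nonneg h0 hs) (by fun_prop),
    integral_eq_lintegral_of_nonneg_ae
      (f := fun t => P.real {ω | t < T ω} * (s * Real.exp (-(s * t))))
      (ae_of_all _ fun t => by positivity)
      (hanti.measurable.mul hdensity.measurable).aestronglyMeasurable, hlayercake]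
  simp only [ENNReal.ofReal_mul measureReal_nonneg, ofReal_measureReal (measure_ne_top P _)]

end LaplaceDefect

lemma ae_frequently_notMem_of_tendsto_measure_zero {α ι : Type*} [MeasurableSpace α]
    {μ : Measure α} {l : Filter ι} [l.NeBot] [l.IsCountablyGenerated] {s : ι → Set α}
    (h : Tendsto (fun i => μ (s i)) l (𝓝 0)) : ∀ᵐ x ∂μ, ∃ᶠ i in l, x ∉ s i := by
  obtain ⟨b, hb⟩ := l.exists_antitone_basis
  have hbasis : ∀ᵐ x ∂μ, ∀ n, ∃ i ∈ b n, x ∉ s i := by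
    refine ae_all_iff.2 fun n => le_antisymm (ge_of_tendsto h ?_) zero_le
    filter_upwards [hb.mem n] with i hi
    exact measure_mono fun x hx => by_contra fun hxi => hx ⟨i, hi, hxi⟩
  filter_upwards [hbasis] with x hx
  exact hb.toHasBasis.frequently_iff.2 fun {n} _ => hx n

/-- The choice `k = ⌈1 / √(u v)⌉` lies between the scales `1 / u` and `1 / v`. -/
lemma exists_nat_mul_tendsto_atTop_and_zero {ι : Type*} {l : Filter ι} {u v : ι → ℝ}
    (hu : ∀ᶠ i in l, 0 < u i) (hv : ∀ᶠ i in l, 0 < v i) (hv0 : Tendsto v l (𝓝 0))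
    (hvu : v =o[l] u) :
    ∃ k : ι → ℕ, Tendsto (fun i => k i * u i) l atTop ∧ Tendsto (fun i => k i * v i) l (𝓝 0) := by
  have hratio : Tendsto (fun i => √(v i / u i)) l (𝓝 0) := by
    simpa using hvu.tendsto_div_nhds_zero.sqrt
  have hratio_pos : ∀ᶠ i in l, 0 < √(v i / u i) := by
    filter_upwards [hu, hv] with i hui hvi
    positivity
  refine ⟨fun i => ⌈1 / √(u i * v i)⌉₊, ?_, ?_⟩
  · refine tendsto_atTop_mono' l ?_
      (tendsto_nhdsWithin_iff.2 ⟨hratio, hratio_pos⟩).inv_tendsto_nhdsGT_zero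
    filter_upwards [hu, hv] with i hui hvi
    calc (√(v i / u i))⁻¹ = 1 / √(u i * v i) * u i := by
          rw [Real.sqrt_div hvi.le, Real.sqrt_mul hui.le]
          field_simp
          rw [Real.sq_sqrt hui.le]
      _ ≤ ⌈1 / √(u i * v i)⌉₊ * u i := by gcongr; exact Nat.le_ceil _
  · refine squeeze_zero' (hv.mono fun i hvi => by positivity) ?_
      (by simpa only [add_zero] using hratio.add hv0)
    filter_upwards [hu, hv] with i hui hvi
    calc ⌈1 / √(u i * v i)⌉₊ * v i ≤ (1 / √(u i * v i) + 1) * v i := by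
          gcongr
          exact (Nat.ceil_lt_add_one (by positivity)).le
      _ = √(v i / u i) + v i := by
          rw [Real.sqrt_div hvi.le, Real.sqrt_mul hui.le]
          field_simp
          linear_combination (-1 : ℝ) * Real.sq_sqrt hvi.le

section RenewalSequences

variable {Ω : Type*} [MeasurableSpace Ω] {P : Measure Ω} {T A B : ℕ → Ω → ℝ}

/-- `T 0, T 1, …` are the inter-event times of a renewal process: independent, identically
distributed, almost surely nonnegative and not almost surely zero. -/
structure IsRenewalSequence (P : Measure Ω) (T : ℕ → Ω → ℝ) : Prop where
  indep : iIndepFun T P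
  identDistrib : ∀ i, IdentDistrib (T i) (T 0) P P
  nonneg : 0 ≤ᵐ[P] T 0
  ne_zero : ¬ T 0 =ᵐ[P] 0

namespace IsRenewalSequence

lemma aemeasurable (hT : IsRenewalSequence P T) (i : ℕ) : AEMeasurable (T i) P :=
  (hT.identDistrib i).aemeasurable_fst

lemma ae_nonneg (hT : IsRenewalSequence P T) : ∀ᵐ ω ∂P, ∀ i, 0 ≤ T i ω :=
  ae_all_iff.2 fun i => (hT.identDistrib i).symm.ae_snd measurableSet_Ici hT.nonneg

lemma aemeasurable_sum (hT : IsRenewalSequence P T) (k : ℕ) :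
    AEMeasurable (fun ω => ∑ i ∈ Finset.range k, T i ω) P :=
  Finset.aemeasurable_fun_sum _ fun i _ => hT.aemeasurable i

lemma sum_nonneg (hT : IsRenewalSequence P T) (k : ℕ) :
    0 ≤ᵐ[P] fun ω => ∑ i ∈ Finset.range k, T i ω :=
  hT.ae_nonneg.mono fun _ω hω => Finset.sum_nonneg fun i _ => hω i

lemma laplaceDefect_sum (hT : IsRenewalSequence P T) (k : ℕ) (s : ℝ) :
    laplaceDefect P (fun ω => ∑ i ∈ Finset.range k, T i ω) s =
      1 - (1 - laplaceDefect P (T 0) s) ^ k := by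
  rw [← Finset.sum_fn, laplaceDefect, laplaceDefect, sub_sub_cancel,
    hT.indep.mgf_sum₀ hT.aemeasurable]
  simp only [mgf_congr_identDistrib (hT.identDistrib _), Finset.prod_const, Finset.card_range]

variable [IsProbabilityMeasure P]

lemma laplaceDefect_pos (hT : IsRenewalSequence P T) {s : ℝ} (hs : 0 < s) :
    0 < laplaceDefect P (T 0) s :=
  MLQueue.laplaceDefect_pos (hT.aemeasurable 0) hT.nonneg hT.ne_zero hs

lemma measureReal_sum_le_le_exp (hT : IsRenewalSequence P T) (k : ℕ) {t : ℝ} (ht : 0 < t) :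
    P.real {ω | ∑ i ∈ Finset.range k, T i ω ≤ t} ≤
      Real.exp 1 * Real.exp (-(k * laplaceDefect P (T 0) t⁻¹)) := by
  refine (measureReal_le_le_mul_one_sub_laplaceDefect (hT.aemeasurable_sum k)
    (hT.sum_nonneg k) ht).trans ?_
  rw [hT.laplaceDefect_sum, sub_sub_cancel, ← mul_neg, Real.exp_nat_mul]
  gcongr
  · exact sub_nonneg.2 laplaceDefect_le_one
  · exact Real.one_sub_le_exp_neg _

lemma measureReal_lt_sum_le_mul (hT : IsRenewalSequence P T) (k : ℕ) {t : ℝ} (ht : 0 < t) :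
    P.real {ω | t < ∑ i ∈ Finset.range k, T i ω} ≤
      (1 - Real.exp (-1))⁻¹ * (k * laplaceDefect P (T 0) t⁻¹) := by
  refine (measureReal_lt_le_mul_laplaceDefect (hT.aemeasurable_sum k) (hT.sum_nonneg k) ht).trans ?_
  have hψ : laplaceDefect P (T 0) t⁻¹ ≤ 1 := laplaceDefect_le_one
  have hbernoulli := one_add_mul_le_pow (a := -laplaceDefect P (T 0) t⁻¹) (by linarith) k
  rw [hT.laplaceDefect_sum, sub_eq_add_neg 1 (laplaceDefect _ _ _)]
  gcongr
  · exact inv_nonneg.2 (sub_nonneg.2 (Real.exp_le_one_iff.2 (by norm_num)))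
  · linarith

variable {ι : Type*} {l : Filter ι} {k : ι → ℕ} {t : ι → ℝ}

lemma tendsto_measure_sum_le (hT : IsRenewalSequence P T) (ht : ∀ᶠ i in l, 0 < t i)
    (hk : Tendsto (fun i => k i * laplaceDefect P (T 0) (t i)⁻¹) l atTop) :
    Tendsto (fun i => P {ω | ∑ j ∈ Finset.range (k i), T j ω ≤ t i}) l (𝓝 0) := by
  refine (ENNReal.tendsto_toReal_zero_iff fun _ => measure_ne_top _ _).1 <|
    squeeze_zero' (Eventually.of_forall fun _ => measureReal_nonneg)
      (ht.mono fun i hti => hT.measureReal_sum_le_le_exp (k i) hti) ?_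
  simpa using (Real.tendsto_exp_neg_atTop_nhds_zero.comp hk).const_mul (Real.exp 1)

lemma tendsto_measure_lt_sum (hT : IsRenewalSequence P T) (ht : ∀ᶠ i in l, 0 < t i)
    (hk : Tendsto (fun i => k i * laplaceDefect P (T 0) (t i)⁻¹) l (𝓝 0)) :
    Tendsto (fun i => P {ω | t i < ∑ j ∈ Finset.range (k i), T j ω}) l (𝓝 0) := by
  refine (ENNReal.tendsto_toReal_zero_iff fun _ => measure_ne_top _ _).1 <|
    squeeze_zero' (Eventually.of_forall fun _ => measureReal_nonneg)
      (ht.mono fun i hti => hT.measureReal_lt_sum_le_mul (k i) hti) ?_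
  simpa using hk.const_mul (1 - Real.exp (-1))⁻¹

lemma ae_tendsto_sum_atTop (hT : IsRenewalSequence P T) :
    ∀ᵐ ω ∂P, Tendsto (fun k => ∑ i ∈ Finset.range k, T i ω) atTop atTop := by
  have hexceeds : ∀ᵐ ω ∂P, ∀ n : ℕ, ∃ᶠ k in atTop,
      ω ∉ {ω | ∑ i ∈ Finset.range k, T i ω ≤ (n + 1 : ℝ)} := by
    refine ae_all_iff.2 fun n => ae_frequently_notMem_of_tendsto_measure_zero ?_
    have hn : (0 : ℝ) < n + 1 := by positivity
    exact hT.tendsto_measure_sum_le (Eventually.of_forall fun _ => hn)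
      (tendsto_natCast_atTop_atTop.atTop_mul_const (hT.laplaceDefect_pos (inv_pos.2 hn)))
  filter_upwards [hT.ae_nonneg, hexceeds] with ω hnonneg hω
  refine tendsto_atTop_atTop_of_monotone (monotone_sum_range hnonneg) fun r => ?_
  obtain ⟨n, hn⟩ := exists_nat_ge r
  obtain ⟨k, hk⟩ := (hω n).exists
  exact ⟨k, by linarith [not_le.1 hk]⟩

lemma exists_tendsto_measure_union_zero (hA : IsRenewalSequence P A) (hB : IsRenewalSequence P B)
    (h : laplaceDefect P (B 0) =o[𝓝[>] 0] laplaceDefect P (A 0)) :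
    ∃ k : ℝ → ℕ, ∀ M : ℕ, Tendsto (fun t => P ({ω | ∑ i ∈ Finset.range (k t), A i ω ≤ t} ∪
      {ω | t < ∑ i ∈ Finset.range (k t + M), B i ω})) atTop (𝓝 0) := by
  have hpos : ∀ᶠ t : ℝ in atTop, 0 < t := eventually_gt_atTop 0
  have hdefect : (fun t => laplaceDefect P (B 0) t⁻¹) =o[atTop]
      fun t => laplaceDefect P (A 0) t⁻¹ := h.comp_tendsto tendsto_inv_atTop_nhdsGT_zero
  have hA_bdd : (fun t => laplaceDefect P (A 0) t⁻¹) =O[atTop] fun _ => (1 : ℝ) := by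
    refine IsBigO.of_bound' (hpos.mono fun t ht => ?_)
    rw [Real.norm_of_nonneg (hA.laplaceDefect_pos (inv_pos.2 ht)).le, norm_one]
    exact laplaceDefect_le_one
  have hB_zero : Tendsto (fun t => laplaceDefect P (B 0) t⁻¹) atTop (𝓝 0) :=
    (isLittleO_one_iff ℝ).1 (hdefect.trans_isBigO hA_bdd)
  obtain ⟨k, hkA, hkB⟩ := exists_nat_mul_tendsto_atTop_and_zero
    (hpos.mono fun t ht => hA.laplaceDefect_pos (inv_pos.2 ht))
    (hpos.mono fun t ht => hB.laplaceDefect_pos (inv_pos.2 ht)) hB_zero hdefect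
  refine ⟨k, fun M => ?_⟩
  have hkMB : Tendsto (fun t => (k t + M : ℕ) * laplaceDefect P (B 0) t⁻¹) atTop (𝓝 0) := by
    simpa [add_mul] using hkB.add (hB_zero.const_mul (M : ℝ))
  have hsum := (hA.tendsto_measure_sum_le hpos hkA).add (hB.tendsto_measure_lt_sum hpos hkMB)
  rw [add_zero] at hsum
  exact tendsto_of_tendsto_of_tendsto_of_le_of_le tendsto_const_nhds hsum (fun _ => zero_le)
    fun _ => measure_union_le _ _

theorem ae_frequently_count_add_le (hA : IsRenewalSequence P A) (hB : IsRenewalSequence P B)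
    (h : laplaceDefect P (B 0) =o[𝓝[>] 0] laplaceDefect P (A 0)) :
    ∀ᵐ ω ∂P, ∀ M : ℕ, ∃ᶠ t in atTop,
      count (fun i => A i ω) t + M ≤ count (fun i => B i ω) t := by
  obtain ⟨k, hk⟩ := hA.exists_tendsto_measure_union_zero hB h
  have hfreq := ae_all_iff.2 fun M => ae_frequently_notMem_of_tendsto_measure_zero (hk M)
  filter_upwards [hA.ae_nonneg, hB.ae_tendsto_sum_atTop, hfreq] with ω hAω hBω hω M
  refine (hω M).mono fun t ht => ?_
  simp only [mem_union, mem_ofPred_eq, not_or, not_le, not_lt] at ht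
  have hcountA := count_le hAω ht.1
  have hcountB := le_count hBω ht.2
  lia

end IsRenewalSequence

end RenewalSequences

section MittagLeffler

variable {α β ν s z : ℝ}

lemma integral_rpow_div_Gamma_mul_exp {a : ℝ} (ha : 0 < a) (hs : 0 < s) :
    ∫ t in Ioi 0, t ^ (a - 1) / Real.Gamma a * Real.exp (-(s * t)) = s ^ (-a) := by
  simp only [div_mul_eq_mul_div]
  rw [integral_div, Real.integral_rpow_mul_exp_neg_mul_Ioi ha hs,
    mul_div_cancel_right₀ _ (Real.Gamma_pos_of_pos ha).ne', one_div, Real.inv_rpow hs.le,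
    Real.rpow_neg hs.le]

lemma integrableOn_rpow_div_Gamma_mul_exp {a : ℝ} (ha : 0 < a) (hs : 0 < s) :
    IntegrableOn (fun t => t ^ (a - 1) / Real.Gamma a * Real.exp (-(s * t))) (Ioi 0) := by
  refine Integrable.of_integral_ne_zero ?_
  rw [integral_rpow_div_Gamma_mul_exp ha hs]
  exact (Real.rpow_pos_of_pos hs _).ne'

lemma rpow_sub_one_mul_mittagLeffler (hs : 0 < s) :
    s ^ (β - 1) * mittagLeffler α β (z * s ^ α) =
      ∑' l : ℕ, z ^ l * (s ^ (β + α * l - 1) / Real.Gamma (β + α * l)) := by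
  rw [mittagLeffler, ← tsum_mul_left]
  refine tsum_congr fun l => ?_
  rw [show β + α * l - 1 = β - 1 + α * l by ring, Real.rpow_add hs, Real.rpow_mul hs.le,
    Real.rpow_natCast]
  ring

lemma pow_mul_rpow_neg_add_mul (hs : 0 < s) (l : ℕ) :
    z ^ l * s ^ (-(β + α * l)) = s ^ (-β) * (z / s ^ α) ^ l := by
  rw [neg_add, Real.rpow_add hs, Real.rpow_neg hs.le (α * l), Real.rpow_mul hs.le,
    Real.rpow_natCast, div_pow]
  ring

lemma integral_rpow_mul_mittagLeffler_mul_exp (hα : 0 < α) (hβ : 0 < β) (hs : 0 < s)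
    (hz : |z| < s ^ α) :
    ∫ t in Ioi 0, t ^ (β - 1) * mittagLeffler α β (z * t ^ α) * Real.exp (-(s * t)) =
      s ^ (α - β) / (s ^ α - z) := by
  have hsα : 0 < s ^ α := Real.rpow_pos_of_pos hs α
  have hexp_pos (l : ℕ) : 0 < β + α * l := by positivity
  set e : ℕ → ℝ → ℝ := fun l t =>
    t ^ (β + α * l - 1) / Real.Gamma (β + α * l) * Real.exp (-(s * t)) with he
  have he_nonneg (l : ℕ) : ∀ t ∈ Ioi (0 : ℝ), 0 ≤ e l t := fun t (ht : 0 < t) =>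
    have := Real.Gamma_pos_of_pos (hexp_pos l)
    by positivity
  have hint (l : ℕ) (c : ℝ) : ∫ t in Ioi 0, c ^ l * e l t = s ^ (-β) * (c / s ^ α) ^ l := by
    rw [integral_const_mul, integral_rpow_div_Gamma_mul_exp (hexp_pos l) hs,
      pow_mul_rpow_neg_add_mul hs]
  have hnorm (l : ℕ) : ∫ t in Ioi 0, ‖z ^ l * e l t‖ = s ^ (-β) * (|z| / s ^ α) ^ l := by
    rw [← hint]
    refine setIntegral_congr_fun measurableSet_Ioi fun t ht => ?_
    simp only [norm_mul, norm_pow, Real.norm_eq_abs, abs_of_nonneg (he_nonneg l t ht)]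
  have hsum : HasSum (fun l => ∫ t in Ioi 0, z ^ l * e l t) (∫ t in Ioi 0, ∑' l, z ^ l * e l t) :=
    hasSum_integral_of_summable_integral_norm
      (fun l => (integrableOn_rpow_div_Gamma_mul_exp (hexp_pos l) hs).const_mul _) <| by
        simp only [hnorm]
        exact (summable_geometric_of_lt_one (by positivity) ((div_lt_one hsα).2 hz)).mul_left _
  have hratio : |z / s ^ α| < 1 := by rwa [abs_div, abs_of_pos hsα, div_lt_one hsα]
  have hz' : s ^ α - z ≠ 0 := (sub_pos.2 ((le_abs_self z).trans_lt hz)).ne'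
  calc ∫ t in Ioi 0, t ^ (β - 1) * mittagLeffler α β (z * t ^ α) * Real.exp (-(s * t))
      = ∫ t in Ioi 0, ∑' l, z ^ l * e l t := by
        refine setIntegral_congr_fun measurableSet_Ioi fun t ht => ?_
        simp only [he, rpow_sub_one_mul_mittagLeffler ht, ← tsum_mul_right, mul_assoc]
    _ = s ^ (-β) * (1 - z / s ^ α)⁻¹ := by
        refine hsum.unique ?_
        simp only [hint]
        exact (hasSum_geometric_of_abs_lt_one hratio).mul_left _
    _ = s ^ (α - β) / (s ^ α - z) := by
        rw [sub_eq_neg_add α β, Real.rpow_add hs, one_sub_div hsα.ne']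
        field_simp

lemma mittagLefflerCDF_zero (hα : α ≠ 0) : mittagLefflerCDF α ν 0 = 0 := by
  have hone : mittagLeffler α 1 0 = 1 := by
    rw [mittagLeffler, tsum_eq_single 0 fun l hl => by rw [zero_pow hl, zero_div]]
    simp
  rw [mittagLefflerCDF, if_neg (lt_irrefl 0), Real.zero_rpow hα, mul_zero, neg_zero, hone, sub_self]

lemma rpow_isLittleO_rpow_nhdsGT_zero (h : α < β) :
    (fun s : ℝ => s ^ β) =o[𝓝[>] 0] fun s => s ^ α := by
  have hgap : Tendsto (fun s : ℝ => s ^ (β - α)) (𝓝[>] 0) (𝓝 0) := by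
    have hcont := Real.continuousAt_rpow_const 0 (β - α) (Or.inr (sub_pos.2 h).le)
    simpa [Real.zero_rpow (sub_pos.2 h).ne'] using hcont.tendsto.mono_left nhdsWithin_le_nhds
  have hprod := (isBigO_refl (fun s : ℝ => s ^ α) (𝓝[>] 0)).mul_isLittleO
    ((isLittleO_one_iff ℝ).2 hgap)
  simp only [mul_one] at hprod
  refine hprod.congr' ?_ EventuallyEq.rfl
  filter_upwards [self_mem_nhdsWithin] with s hs
  rw [← Real.rpow_add hs, add_sub_cancel]

variable {Ω : Type*} [MeasurableSpace Ω] {P : Measure Ω} {S T : Ω → ℝ}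

/-- The real random variable `T` has the Mittag-Leffler law with tail index `α` and scaling `ν`,
expressed through its cumulative distribution function as in `IsMittagLefflerSequence`. -/
structure HasMittagLefflerLaw (P : Measure Ω) (α ν : ℝ) (T : Ω → ℝ) : Prop where
  measurable : Measurable T
  measureReal_le : ∀ x, P.real {ω | T ω ≤ x} = mittagLefflerCDF α ν x

namespace HasMittagLefflerLaw

lemma identDistrib [IsFiniteMeasure P] (hS : HasMittagLefflerLaw P α ν S)
    (hT : HasMittagLefflerLaw P α ν T) : IdentDistrib S T P P where
  aemeasurable_fst := hS.measurable.aemeasurable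
  aemeasurable_snd := hT.measurable.aemeasurable
  map_eq := Measure.ext_of_Iic _ _ fun x => by
    rw [Measure.map_apply hS.measurable measurableSet_Iic,
      Measure.map_apply hT.measurable measurableSet_Iic, ← measureReal_eq_measureReal_iff]
    exact (hS.measureReal_le x).trans (hT.measureReal_le x).symm

lemma ae_pos [IsFiniteMeasure P] (hT : HasMittagLefflerLaw P α ν T) (hα : α ≠ 0) :
    ∀ᵐ ω ∂P, 0 < T ω := by
  have hzero : P {ω | T ω ≤ 0} = 0 := by
    rw [← measureReal_eq_zero_iff, hT.measureReal_le, mittagLefflerCDF_zero hα]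
  simpa only [ae_iff, not_lt] using hzero

variable [IsProbabilityMeasure P]

lemma measureReal_lt (hT : HasMittagLefflerLaw P α ν T) {x : ℝ} (hx : 0 ≤ x) :
    P.real {ω | x < T ω} = mittagLeffler α 1 (-ν ^ α * x ^ α) := by
  have hcompl : {ω | x < T ω} = {ω | T ω ≤ x}ᶜ := by simp only [compl_ofPred, not_le]
  rw [hcompl, probReal_compl_eq_one_sub (measurableSet_le hT.measurable measurable_const),
    hT.measureReal_le, mittagLefflerCDF, if_neg hx.not_gt, sub_sub_cancel, neg_mul]

lemma laplaceDefect_eq_of_lt (hT : HasMittagLefflerLaw P α ν T) (hα : 0 < α) (hν : 0 < ν)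
    (hs : ν < s) : laplaceDefect P T s = s ^ α / (s ^ α + ν ^ α) := by
  have hs0 : 0 < s := hν.trans hs
  have hν_lt : |-ν ^ α| < s ^ α := by
    rw [abs_neg, abs_of_pos (Real.rpow_pos_of_pos hν α)]
    exact Real.rpow_lt_rpow hν.le hs hα
  have hnonneg : 0 ≤ᵐ[P] T := (hT.ae_pos hα.ne').mono fun _ h => h.le
  calc laplaceDefect P T s
      = ∫ t in Ioi 0, P.real {ω | t < T ω} * (s * Real.exp (-(s * t))) :=
        laplaceDefect_eq_integral_tail hT.measurable.aemeasurable hnonneg hs0.le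
    _ = ∫ t in Ioi 0,
          s * (t ^ ((1 : ℝ) - 1) * mittagLeffler α 1 (-ν ^ α * t ^ α) * Real.exp (-(s * t))) := by
        refine setIntegral_congr_fun measurableSet_Ioi fun t (ht : 0 < t) => ?_
        simp only [hT.measureReal_lt ht.le, sub_self, Real.rpow_zero]
        ring
    _ = s ^ α / (s ^ α + ν ^ α) := by
        rw [integral_const_mul, integral_rpow_mul_mittagLeffler_mul_exp hα one_pos hs0 hν_lt,
          sub_neg_eq_add, Real.rpow_sub_one hs0.ne']
        field_simp

/-- Termwise integration of the Mittag-Leffler series only reaches `s > ν`, hence the analytic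
continuation to small `s`. -/
lemma laplaceDefect_eq (hT : HasMittagLefflerLaw P α ν T) (hα : 0 < α) (hν : 0 < ν) (hs : 0 < s) :
    laplaceDefect P T s = s ^ α / (s ^ α + ν ^ α) := by
  have hnonneg : 0 ≤ᵐ[P] T := (hT.ae_pos hα.ne').mono fun _ h => h.le
  have hrational : AnalyticOnNhd ℝ (fun s : ℝ => s ^ α / (s ^ α + ν ^ α)) (Ioi 0) := by
    intro x (hx : 0 < x)
    have hpow : AnalyticAt ℝ (fun s : ℝ => s ^ α) x :=
      (Real.contDiffAt_rpow_const_of_ne hx.ne').analyticAt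
    exact hpow.div (hpow.add analyticAt_const) (by positivity)
  have hlarge : laplaceDefect P T =ᶠ[𝓝 (ν + 1)] fun s => s ^ α / (s ^ α + ν ^ α) := by
    filter_upwards [Ioi_mem_nhds (lt_add_one ν)] with x hx
    exact hT.laplaceDefect_eq_of_lt hα hν hx
  exact (analyticOnNhd_laplaceDefect hT.measurable.aemeasurable
    hnonneg).eqOn_of_preconnected_of_eventuallyEq hrational isPreconnected_Ioi
    (mem_Ioi.2 (by positivity)) hlarge hs

lemma laplaceDefect_isTheta (hT : HasMittagLefflerLaw P α ν T) (hα : 0 < α) (hν : 0 < ν) :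
    laplaceDefect P T =Θ[𝓝[>] 0] fun s => s ^ α := by
  have hνα : 0 < ν ^ α := Real.rpow_pos_of_pos hν α
  refine isTheta_of_div_tendsto_nhds_ne_zero (c := ν ^ α) ?_ hνα.ne'
  have hlim : Tendsto (fun s : ℝ => s ^ α + ν ^ α) (𝓝[>] 0) (𝓝 (ν ^ α)) := by
    have hcont := (Real.continuousAt_rpow_const 0 α (Or.inr hα.le)).add_const (ν ^ α)
    simpa [Real.zero_rpow hα.ne'] using hcont.tendsto.mono_left nhdsWithin_le_nhds
  refine hlim.congr' ?_
  filter_upwards [self_mem_nhdsWithin] with s (hs : 0 < s)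
  rw [hT.laplaceDefect_eq hα hν hs, div_div_cancel₀ (Real.rpow_pos_of_pos hs α).ne']

lemma laplaceDefect_isLittleO {κ : ℝ} (hS : HasMittagLefflerLaw P α ν S)
    (hT : HasMittagLefflerLaw P β κ T) (hα : 0 < α) (hν : 0 < ν) (hκ : 0 < κ) (h : α < β) :
    laplaceDefect P T =o[𝓝[>] 0] laplaceDefect P S :=
  (hT.laplaceDefect_isTheta (hα.trans h) hκ).trans_isLittleO <|
    (rpow_isLittleO_rpow_nhdsGT_zero h).trans_isTheta (hS.laplaceDefect_isTheta hα hν).symm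

end HasMittagLefflerLaw

namespace IsMittagLefflerSequence

variable {T : ℕ → Ω → ℝ}

lemma hasMittagLefflerLaw (hT : IsMittagLefflerSequence P α ν T) (i : ℕ) :
    HasMittagLefflerLaw P α ν (T i) :=
  ⟨hT.measurable i, hT.law i⟩

lemma isRenewalSequence [IsProbabilityMeasure P] (hT : IsMittagLefflerSequence P α ν T)
    (hα : α ≠ 0) : IsRenewalSequence P T where
  indep := hT.indep
  identDistrib i := (hT.hasMittagLefflerLaw i).identDistrib (hT.hasMittagLefflerLaw 0)
  nonneg := ((hT.hasMittagLefflerLaw 0).ae_pos hα).mono fun _ h => h.le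
  ne_zero h := by
    obtain ⟨ω, hzero, hpos⟩ := (h.and ((hT.hasMittagLefflerLaw 0).ae_pos hα)).exists
    exact hpos.ne' hzero

end IsMittagLefflerSequence

end MittagLeffler

end MLQueue

open Asymptotics Topology in
theorem mainTheorem5_general {Ω : Type*} [MeasurableSpace Ω] (P : Measure Ω)
    [IsProbabilityMeasure P] (X Y : ℕ → Ω → ℝ) (hX : MLQueue.IsRenewalSequence P X)
    (hY : MLQueue.IsRenewalSequence P Y) :
    (MLQueue.laplaceDefect P (Y 0) =o[𝓝[>] 0] MLQueue.laplaceDefect P (X 0) →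
      ∀ᵐ ω ∂P, ∃ᶠ t : ℝ in atTop,
        MLQueue.queueLength (fun i => X i ω) (fun i => Y i ω) t = 0) ∧
    (MLQueue.laplaceDefect P (X 0) =o[𝓝[>] 0] MLQueue.laplaceDefect P (Y 0) →
      ∀ᵐ ω ∂P, limsup (fun t : ℝ =>
        ((MLQueue.queueLength (fun i => X i ω) (fun i => Y i ω) t : ℝ) : EReal)) atTop = ⊤) := by
  constructor <;> intro h
  · filter_upwards [hY.ae_tendsto_sum_atTop, hX.ae_frequently_count_add_le hY h] with ω hYω hω
    exact MLQueue.frequently_queueLength_eq_zero hYω hω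
  · filter_upwards [hY.ae_tendsto_sum_atTop, hY.ae_frequently_count_add_le hX h] with ω hYω hω
    exact MLQueue.limsup_queueLength_eq_top hYω hω

theorem mainTheorem5 {Ω : Type*} [MeasurableSpace Ω] (P : Measure Ω) [IsProbabilityMeasure P]
    (α₁ α₂ lam mu : ℝ) (hα₁ : α₁ ∈ Ioo (0 : ℝ) 1) (hα₂ : α₂ ∈ Ioo (0 : ℝ) 1)
    (hlam : 0 < lam) (hmu : 0 < mu) (X Y : ℕ → Ω → ℝ)
    (hX : MLQueue.IsMittagLefflerSequence P α₁ lam X)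
    (hY : MLQueue.IsMittagLefflerSequence P α₂ mu Y)
    (hXY : IndepFun (fun ω i => X i ω) (fun ω i => Y i ω) P) :
    (α₁ < α₂ → ∀ᵐ ω ∂P, ∃ᶠ t : ℝ in atTop,
      MLQueue.queueLength (fun i => X i ω) (fun i => Y i ω) t = 0) ∧
    (α₂ < α₁ → ∀ᵐ ω ∂P, limsup (fun t : ℝ =>
      ((MLQueue.queueLength (fun i => X i ω) (fun i => Y i ω) t : ℝ) : EReal)) atTop = ⊤) := by
  have h := mainTheorem5_general P X Y (hX.isRenewalSequence hα₁.1.ne')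
    (hY.isRenewalSequence hα₂.1.ne')
  have hX₀ := hX.hasMittagLefflerLaw 0
  have hY₀ := hY.hasMittagLefflerLaw 0
  exact ⟨fun hlt => h.1 (hX₀.laplaceDefect_isLittleO hY₀ hα₁.1 hlam hmu hlt),
    fun hlt => h.2 (hY₀.laplaceDefect_isLittleO hX₀ hα₂.1 hmu hlam hlt)⟩
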